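/- Let $A$ be a (bounded or unbounded) scalar type spectral operator in a complex Banach space $(X,\|\cdot\|)$ with spectral measure $E_A$; that is, $E_A$ is a strongly $\sigma$-additive projection-valued measure on the Borel sets of $\mathbb{C}$ with $E_A(\mathbb{C})=I$ and $E_A(\delta\cap\varepsilon)=E_A(\delta)E_A(\varepsilon)$, and $A=\int_{\mathbb{C}}\lambda\,dE_A(\lambda)$. Here, for a Borel function $F$, the operator $\int F\,dE_A$ is given by $\left(\int F\,dE_A\right)f=\lim_{n\to\infty}\left(\int F_n\,dE_A\right)f$ on the domain of all $f\in X$ for which this limit exists, where $F_n=F$ on $\{|F|\le n\}$ and $F_n=0$ elsewhere. Suppose that $\sigma(A)\subseteq i\mathbb{R}$ and let $$e^{tA}:=\int_{\sigma(A)}e^{t\lambda}\,dE_A(\lambda),\qquad t\in\mathbb{R}.$$ Then $\{e^{tA}\}_{t\in\mathbb{R}}$ is a strongly continuous group of bounded linear operators defined on all of $X$; its generator is $A$, and it is the only strongly continuous group with generator $A$. There is an $M\ge 1$ such that $\|E_A(\delta)\|\le M$ for every Borel set $\delta\subseteq\mathbb{C}$, and for every such $M$ $$\|e^{tA}\|\le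 4M,\qquad t\in\mathbb{R}.$$ Thus the group is bounded, every orbit $\{e^{tA}f\}_{t\in\mathbb{R}}$, $f\in X$, is bounded, and the group is not hypercyclic: there is no nonzero vector $f\in X$ whose orbit $\{e^{tA}f\}_{t\in\mathbb{R}}$ is dense in $X$. -/

import Mathlib

open Filter Topology

noncomputable section

namespace ScalarSpectral

variable {X : Type*} [NormedAddCommGroup X] [NormedSpace ℂ X]

/-- The strong limit, along a filter `l`, of a family of everywhere defined linear operators, as an
(in general unbounded) operator: its domain consists of all `x` for which `T i x` converges
along `l`, and its value at such an `x` is the limit. -/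
def strongLimit {ι : Type*} (l : Filter ι) [l.NeBot] (T : ι → X →L[ℂ] X) : X →ₗ.[ℂ] X where
  domain :=
    { carrier := {x | ∃ y, Tendsto (fun i => T i x) l (𝓝 y)}
      add_mem' := by
        rintro a b ⟨y, hy⟩ ⟨z, hz⟩
        exact ⟨y + z, by simpa using hy.add hz⟩
      zero_mem' := ⟨0, by simp⟩
      smul_mem' := by
        rintro c a ⟨y, hy⟩
        exact ⟨c • y, by simpa using hy.const_smul c⟩ }
  toFun :=
    { toFun := fun x => Classical.choose x.2
      map_add' := by
        intro a b
        refine tendsto_nhds_unique (Classical.choose_spec (a + b).2) ?_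
        simpa using (Classical.choose_spec a.2).add (Classical.choose_spec b.2)
      map_smul' := by
        intro c a
        refine tendsto_nhds_unique (Classical.choose_spec (c • a).2) ?_
        simpa using (Classical.choose_spec a.2).const_smul c }

theorem mem_strongLimit_domain {ι : Type*} {l : Filter ι} [l.NeBot] {T : ι → X →L[ℂ] X} {x : X} :
    x ∈ (strongLimit l T).domain ↔ ∃ y, Tendsto (fun i => T i x) l (𝓝 y) := Iff.rfl

theorem tendsto_strongLimit {ι : Type*} {l : Filter ι} [l.NeBot] {T : ι → X →L[ℂ] X}
    (x : (strongLimit l T).domain) :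
    Tendsto (fun i => T i x) l (𝓝 (strongLimit l T x)) := Classical.choose_spec x.2

/-- The point `z` belongs to the resolvent set of the operator `A`: the operator `A - z I`, defined
on the domain of `A`, has an everywhere defined bounded two-sided inverse `R`. -/
def IsResolventPoint (A : X →ₗ.[ℂ] X) (z : ℂ) : Prop :=
  ∃ R : X →L[ℂ] X,
    (∀ y : X, ∃ h : R y ∈ A.domain, A ⟨R y, h⟩ - z • R y = y) ∧
    ∀ x : A.domain, R (A x - z • (x : X)) = x

/-- The spectrum `σ(A)` of a possibly unbounded operator. -/
def spectrum (A : X →ₗ.[ℂ] X) : Set ℂ := {z | ¬ IsResolventPoint A z}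

variable (X) in
/-- A strongly `σ`-additive spectral measure on the Borel sets of the complex plane. Only the values
at Borel sets matter. By `inter'`, the operators `E δ` are commuting projections. -/
structure SpectralMeasure where
  toFun : Set ℂ → X →L[ℂ] X
  univ' : toFun Set.univ = 1
  inter' : ∀ δ ε : Set ℂ, MeasurableSet δ → MeasurableSet ε →
    toFun (δ ∩ ε) = toFun δ * toFun ε
  iUnion' : ∀ δ : ℕ → Set ℂ, (∀ n, MeasurableSet (δ n)) → Pairwise (Function.onFun Disjoint δ) →
    ∀ x : X, HasSum (fun n => toFun (δ n) x) (toFun (⋃ n, δ n) x)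

instance : CoeFun (SpectralMeasure X) (fun _ => Set ℂ → X →L[ℂ] X) := ⟨SpectralMeasure.toFun⟩

namespace SpectralMeasure

/-- The integral `∑ c, c E({s = c})` of a simple Borel function `s`. -/
def simpleIntegral (E : SpectralMeasure X) (s : MeasureTheory.SimpleFunc ℂ ℂ) : X →L[ℂ] X :=
  ∑ c ∈ s.range, c • E (s ⁻¹' {c})

/-- `T` is the integral of the bounded Borel function `F`: the limit in operator norm of the integrals
of simple Borel functions that converge to `F` uniformly. -/
def HasBoundedIntegral (E : SpectralMeasure X) (F : ℂ → ℂ) (T : X →L[ℂ] X) : Prop :=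
  ∃ s : ℕ → MeasureTheory.SimpleFunc ℂ ℂ,
    TendstoUniformly (fun n z => s n z) F atTop ∧
    Tendsto (fun n => E.simpleIntegral (s n)) atTop (𝓝 T)

open Classical in
/-- The bounded operator `∫ F dE` for a bounded Borel function `F` (and `0` if there is none). -/
def boundedIntegral (E : SpectralMeasure X) (F : ℂ → ℂ) : X →L[ℂ] X :=
  if h : ∃ T, E.HasBoundedIntegral F T then Classical.choose h else 0

/-- The truncation `F_n`, equal to `F` where `|F| ≤ n` and to `0` elsewhere. -/
def truncation (F : ℂ → ℂ) (n : ℕ) : ℂ → ℂ := Set.indicator {z | ‖F z‖ ≤ n} F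

/-- The operator `∫ F dE` for an arbitrary Borel function `F : ℂ → ℂ`: the domain consists of
all `x` for which the sequence `(∫ F_n dE) x` converges, and the value at `x` is its limit. -/
def integral (E : SpectralMeasure X) (F : ℂ → ℂ) : X →ₗ.[ℂ] X :=
  strongLimit atTop (fun n : ℕ => E.boundedIntegral (truncation F n))

/-- `A` is a scalar type spectral operator with spectral measure `E`, that is `A = ∫ λ dE(λ)`. -/
def IsSpectralMeasureOf (E : SpectralMeasure X) (A : X →ₗ.[ℂ] X) : Prop :=
  A = E.integral (fun z => z)

/-- The operator `F(A) = ∫_{σ(A)} F dE` of the Borel operational calculus. -/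
def calculus (E : SpectralMeasure X) (A : X →ₗ.[ℂ] X) (F : ℂ → ℂ) : X →ₗ.[ℂ] X :=
  E.integral (Set.indicator (spectrum A) F)

/-- The exponential `e^{tA} = ∫_{σ(A)} e^{tλ} dE(λ)`. -/
def expOp (E : SpectralMeasure X) (A : X →ₗ.[ℂ] X) (t : ℝ) : X →ₗ.[ℂ] X :=
  E.calculus A (fun z => Complex.exp (t * z))

end SpectralMeasure

/-- A strongly continuous one-parameter group of bounded linear operators. -/
structure IsStronglyContinuousGroup (T : ℝ → X →L[ℂ] X) : Prop where
  map_zero : T 0 = 1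
  map_add : ∀ s t : ℝ, T (s + t) = T s * T t
  continuous : ∀ x : X, Continuous (fun t => T t x)

/-- The generator of a one-parameter group: `x ↦ lim_{t → 0} t⁻¹ (T(t) x - x)`, defined for those `x`
for which this limit exists. -/
def generator (T : ℝ → X →L[ℂ] X) : X →ₗ.[ℂ] X :=
  strongLimit (𝓝[≠] (0 : ℝ)) (fun t => ((t : ℂ)⁻¹) • (T t - 1))

/-- `f` is a hypercyclic vector of the collection `T` of (possibly unbounded) linear operators: a nonzero
vector, in the domain of every `T j`, whose orbit `{T j f}` is dense. -/
def IsHypercyclicVector {J : Type*} (T : J → X →ₗ.[ℂ] X) (f : X) : Prop :=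
  f ≠ 0 ∧ ∃ h : ∀ j, f ∈ (T j).domain, Dense (Set.range fun j => T j ⟨f, h j⟩)

/-- A collection of linear operators is hypercyclic if it possesses a hypercyclic vector. -/
def IsHypercyclic {J : Type*} (T : J → X →ₗ.[ℂ] X) : Prop :=
  ∃ f, IsHypercyclicVector T f

end ScalarSpectral

end

noncomputable section

namespace ScalarSpectral

variable {X : Type*} [NormedAddCommGroup X] [NormedSpace ℂ X]

open MeasureTheory

/-! The spectral measure has a bounded range (`exists_norm_le`). For a functional `φ`, the scalar
measure `φ(E(·)x)` then has total variation at most four times its supremum, so integrals of simple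
functions are bounded by `4 * M * sup` (`norm_simpleIntegral_le`). Hence `F ↦ ∫ F dE` is a
well-defined, bounded, multiplicative calculus on bounded Borel functions.

`E` vanishes near each resolvent point, so by Lindelöf `E(σ(A)) = 1` (`proj_spectrum`). On the
imaginary axis `|e^{tλ}| = 1`, so the exponentials fall under the bounded calculus: the group law is
multiplicativity, the bound `4 * M` is the norm estimate, and strong continuity is bounded
convergence (`tendsto_boundedIntegral`).

For the generator, write `e^{tλ} - 1 = tλ q(tλ)` with `q(w) = (e^w - 1)/w`. On the imaginary axis
`|q| ≤ 1`, and `q(tλ) → 1` uniformly on disks, so `∫ q(tλ) dE → 1` strongly. Cutting down by `E(disk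
n)` makes everything bounded, and the limits in `n` and `t` give both inclusions of domains
(`generator_expGroup`).

If `U` is another group with this generator, `T(-t) U(t) x` has derivative zero for `x` in the dense
domain, so `U = T`. Finally, a bounded orbit cannot be dense in a nonzero normed space. -/

/-! ### Absolute sums controlled by partial sums. -/

/-- If all partial sums of a finite family of reals are bounded by `K`, then the sum of the absolute
values is at most `2 * K`. -/
theorem sum_abs_le_of_forall_abs_sum_le {ι : Type*} (R : Finset ι) (b : ι → ℝ) (K : ℝ)
    (h : ∀ J ⊆ R, |∑ i ∈ J, b i| ≤ K) : ∑ i ∈ R, |b i| ≤ 2 * K := by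
  rw [← Finset.sum_filter_add_sum_filter_not R (fun i => 0 ≤ b i), two_mul]
  refine add_le_add ?_ ?_
  · rw [Finset.sum_congr rfl fun i hi => abs_of_nonneg (Finset.mem_filter.1 hi).2]
    exact (le_abs_self _).trans (h _ (Finset.filter_subset _ _))
  · rw [Finset.sum_congr rfl fun i hi => abs_of_neg (not_le.1 (Finset.mem_filter.1 hi).2),
      Finset.sum_neg_distrib]
    exact (neg_le_abs _).trans (h _ (Finset.filter_subset _ _))

/-- If all partial sums of a finite family of complex numbers are bounded by `K`, then the sum of the
absolute values is at most `4 * K`. -/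
theorem sum_norm_le_of_forall_norm_sum_le {ι : Type*} (R : Finset ι) (a : ι → ℂ) (K : ℝ)
    (h : ∀ J ⊆ R, ‖∑ i ∈ J, a i‖ ≤ K) : ∑ i ∈ R, ‖a i‖ ≤ 4 * K := by
  have hre := sum_abs_le_of_forall_abs_sum_le R (fun i => (a i).re) K fun J hJ => by
    rw [← Complex.re_sum]; exact (Complex.abs_re_le_norm _).trans (h J hJ)
  have him := sum_abs_le_of_forall_abs_sum_le R (fun i => (a i).im) K fun J hJ => by
    rw [← Complex.im_sum]; exact (Complex.abs_im_le_norm _).trans (h J hJ)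
  calc ∑ i ∈ R, ‖a i‖ ≤ ∑ i ∈ R, (|(a i).re| + |(a i).im|) :=
        Finset.sum_le_sum fun i _ => Complex.norm_le_abs_re_add_abs_im _
    _ ≤ 4 * K := by rw [Finset.sum_add_distrib]; linarith

/-! ### Additivity and boundedness of `E`; integrals of simple functions. -/

namespace SpectralMeasure

variable (E : SpectralMeasure X)

@[simp]
theorem apply_empty : E ∅ = 0 := by
  ext x
  have h := E.iUnion' (fun _ => ∅) (fun _ => MeasurableSet.empty)
    (fun _ _ _ => by simp [Function.onFun]) x
  -- A constant series over an infinite index set converges only if its term is zero.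
  exact (summable_const_iff (β := ℕ) _).1 h.summable

theorem apply_union {δ ε : Set ℂ} (hδ : MeasurableSet δ) (hε : MeasurableSet ε)
    (h : Disjoint δ ε) : E (δ ∪ ε) = E δ + E ε := by
  classical
  ext x
  let f : ℕ → Set ℂ := fun n => if n = 0 then δ else if n = 1 then ε else ∅
  have hU : ⋃ n, f n = δ ∪ ε := by
    ext z
    simp only [Set.mem_iUnion, Set.mem_union]
    constructor
    · rintro ⟨n, hn⟩
      by_cases h0 : n = 0
      · left; simpa [f, h0] using hn
      · by_cases h1 : n = 1
        · right; simpa [f, h1] using hn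
        · simp [f, h0, h1] at hn
    · rintro (hz | hz)
      · exact ⟨0, by simpa [f] using hz⟩
      · exact ⟨1, by simpa [f] using hz⟩
  have key := E.iUnion' f (fun n => by dsimp only [f]; split_ifs <;> simp [hδ, hε])
    (fun i j hij => by
      dsimp only [Function.onFun, f]
      split_ifs <;> first | omega | exact h | exact h.symm | simp) x
  rw [hU] at key
  refine key.unique ?_
  have hs := hasSum_sum_of_ne_finset_zero (f := fun n => E (f n) x) (s := Finset.range 2)
    (L := SummationFilter.unconditional ℕ)
    (fun n hn => by
      have : n ≠ 0 ∧ n ≠ 1 := by simp at hn; omega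
      simp [f, this.1, this.2])
  simpa [Finset.sum_range_succ, f] using hs

theorem apply_biUnion {ι : Type*} (J : Finset ι) (f : ι → Set ℂ)
    (hf : ∀ i, MeasurableSet (f i)) (hd : Pairwise (Function.onFun Disjoint f)) :
    E (⋃ i ∈ J, f i) = ∑ i ∈ J, E (f i) := by
  classical
  induction J using Finset.induction_on with
  | empty => simp
  | insert a J ha ih =>
    rw [Finset.set_biUnion_insert, E.apply_union (hf a) (J.measurableSet_biUnion fun i _ => hf i),
      ih, Finset.sum_insert ha]
    rw [Set.disjoint_iUnion₂_right]
    exact fun i hi => hd fun h => ha (h ▸ hi)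

theorem tendsto_apply_iUnion {δ : ℕ → Set ℂ} (hδ : ∀ n, MeasurableSet (δ n)) (hm : Monotone δ)
    (x : X) : Tendsto (fun n => E (δ n) x) atTop (𝓝 (E (⋃ n, δ n) x)) := by
  have h := (E.iUnion' (disjointed δ) (fun n => MeasurableSet.disjointed hδ n)
    (disjoint_disjointed δ) x).tendsto_sum_nat
  rw [iUnion_disjointed] at h
  rw [← tendsto_add_atTop_iff_nat 1] at h
  refine h.congr fun n => ?_
  have := E.apply_biUnion (Finset.range (n + 1)) (disjointed δ)
    (fun n => MeasurableSet.disjointed hδ n) (disjoint_disjointed δ)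
  rw [← sum_apply, ← this]
  congr 2
  have h3 := DFunLike.congr_fun (partialSups_disjointed δ) n
  rw [hm.partialSups_eq] at h3
  rw [← h3, partialSups_eq_biSup]
  ext z; simp

/-- Each disjointed piece `P ⊆ δ n` satisfies `E P = E P * E (δ n) = 0`. -/
theorem apply_iUnion_eq_zero {δ : ℕ → Set ℂ} (hδ : ∀ n, MeasurableSet (δ n))
    (h : ∀ n, E (δ n) = 0) : E (⋃ n, δ n) = 0 := by
  ext x
  have h1 := E.iUnion' (disjointed δ) (fun n => MeasurableSet.disjointed hδ n)
    (disjoint_disjointed δ) x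
  rw [iUnion_disjointed] at h1
  refine h1.unique ?_
  simp only [zero_apply]
  convert hasSum_zero with n
  have : disjointed δ n = disjointed δ n ∩ δ n :=
    (Set.inter_eq_left.2 (disjointed_subset δ n)).symm
  rw [this, E.inter' _ _ (MeasurableSet.disjointed hδ n) (hδ n), h n]
  simp

open Classical in
/-- The vector measure `δ ↦ E δ x`. -/
def vectorMeasure (x : X) : MeasureTheory.VectorMeasure ℂ X where
  measureOf' δ := if MeasurableSet δ then E δ x else 0
  empty' := by simp
  not_measurable' _ h := if_neg h
  m_iUnion' f hf hd := by
    simp only [hf, if_true, MeasurableSet.iUnion hf]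
    exact E.iUnion' f hf hd x

/-- A vector measure has bounded range, so the family `E δ` is pointwise bounded and the uniform
boundedness principle applies. -/
theorem exists_norm_le [CompleteSpace X] :
    ∃ M : ℝ, 1 ≤ M ∧ ∀ δ : Set ℂ, MeasurableSet δ → ‖E δ‖ ≤ M := by
  obtain ⟨C, hC⟩ := banach_steinhaus (g := fun δ : {δ : Set ℂ // MeasurableSet δ} => E δ.1)
    fun x => ⟨(E.vectorMeasure x).bound, fun δ => by
      have h := (E.vectorMeasure x).norm_apply_le_bound (s := δ.1)
      have h2 : E.vectorMeasure x δ.1 = E δ.1 x := if_pos δ.2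
      rwa [h2] at h⟩
  exact ⟨max 1 C, le_max_left _ _, fun δ hδ => (hC ⟨δ, hδ⟩).trans (le_max_right _ _)⟩

/-- Tested against `φ`, partial sums over the disjoint fibres equal `φ (E (⋃ ...) x)`, hence are at
most `‖φ‖ * M * ‖x‖`. Passing to absolute values costs the factor 4, and Hahn–Banach removes `φ`. -/
theorem norm_simpleIntegral_le {M : ℝ} (hM : ∀ δ : Set ℂ, MeasurableSet δ → ‖E δ‖ ≤ M)
    (s : SimpleFunc ℂ ℂ) {r : ℝ} (hr : ∀ z, ‖s z‖ ≤ r) : ‖E.simpleIntegral s‖ ≤ 4 * M * r := by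
  have hM0 : 0 ≤ M := (norm_nonneg _).trans (hM ∅ MeasurableSet.empty)
  have hr0 : 0 ≤ r := (norm_nonneg _).trans (hr 0)
  refine ContinuousLinearMap.opNorm_le_bound _ (by positivity) fun x => ?_
  refine NormedSpace.norm_le_dual_bound ℂ _ (by positivity) fun φ => ?_
  have hsum : ∑ c ∈ s.range, ‖φ (E (s ⁻¹' {c}) x)‖ ≤ 4 * (‖φ‖ * (M * ‖x‖)) := by
    refine sum_norm_le_of_forall_norm_sum_le _ _ _ fun J _ => ?_
    have : ∑ c ∈ J, φ (E (s ⁻¹' {c}) x) = φ (E (⋃ c ∈ J, s ⁻¹' {c}) x) := by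
      rw [E.apply_biUnion J (fun c => s ⁻¹' {c}) (fun c => s.measurableSet_fiber c)]
      · simp
      · intro a b hab
        exact Disjoint.preimage _ (by simpa using hab)
    rw [this]
    refine (φ.le_opNorm _).trans ?_
    gcongr
    refine (ContinuousLinearMap.le_opNorm _ _).trans ?_
    gcongr
    exact hM _ (J.measurableSet_biUnion fun c _ => s.measurableSet_fiber c)
  calc ‖φ (E.simpleIntegral s x)‖ = ‖∑ c ∈ s.range, c * φ (E (s ⁻¹' {c}) x)‖ := by
        simp [simpleIntegral]
    _ ≤ ∑ c ∈ s.range, r * ‖φ (E (s ⁻¹' {c}) x)‖ := by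
        refine norm_sum_le_of_le _ fun c hc => ?_
        obtain ⟨z, rfl⟩ := SimpleFunc.mem_range.1 hc
        rw [norm_mul]
        gcongr
        exact hr z
    _ = r * ∑ c ∈ s.range, ‖φ (E (s ⁻¹' {c}) x)‖ := (Finset.mul_sum _ _ _).symm
    _ ≤ r * (4 * (‖φ‖ * (M * ‖x‖))) := by gcongr
    _ = 4 * M * r * ‖x‖ * ‖φ‖ := by ring

/-- The finitely additive set function `δ ↦ (c ↦ c • E δ)`. -/
def smulRightFun (δ : Set ℂ) : ℂ →L[ℝ] (X →L[ℂ] X) :=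
  (ContinuousLinearMap.toSpanSingleton ℂ (E δ)).restrictScalars ℝ

theorem simpleIntegral_eq_setToSimpleFunc (s : SimpleFunc ℂ ℂ) :
    E.simpleIntegral s = s.setToSimpleFunc E.smulRightFun := by
  simp [simpleIntegral, SimpleFunc.setToSimpleFunc, smulRightFun]

/-- With the zero measure all finiteness and integrability conditions are void, so the
`setToSimpleFunc` API applies to every simple function. -/
theorem finMeasAdditive_smulRightFun :
    FinMeasAdditive (0 : Measure ℂ) E.smulRightFun := by
  intro δ ε hδ hε _ _ hd
  ext1
  simp [smulRightFun, E.apply_union hδ hε hd]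

theorem simpleIntegral_sub (s t : SimpleFunc ℂ ℂ) :
    E.simpleIntegral (s - t) = E.simpleIntegral s - E.simpleIntegral t := by
  simp only [simpleIntegral_eq_setToSimpleFunc]
  exact SimpleFunc.setToSimpleFunc_sub _ E.finMeasAdditive_smulRightFun
    (integrable_zero_measure) (integrable_zero_measure)

/-- On the common refinement by fibres of `(s, t)`, `inter'` factors each projection; pairs of
values not attained have empty fibre and contribute zero. -/
theorem simpleIntegral_mul (s t : SimpleFunc ℂ ℂ) :
    E.simpleIntegral (s * t) = E.simpleIntegral s * E.simpleIntegral t := by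
  have h : E.simpleIntegral (s * t) =
      ∑ p ∈ (s.pair t).range, (p.1 * p.2) • E (s.pair t ⁻¹' {p}) := by
    rw [simpleIntegral_eq_setToSimpleFunc, SimpleFunc.mul_eq_map₂,
      SimpleFunc.map_setToSimpleFunc _ E.finMeasAdditive_smulRightFun
        integrable_zero_measure (by simp)]
    simp [smulRightFun]
  have hsub : (s.pair t).range ⊆ s.range ×ˢ t.range := by
    intro p hp
    obtain ⟨z, rfl⟩ := SimpleFunc.mem_range.1 hp
    simp
  rw [h, Finset.sum_subset hsub, Finset.sum_product, simpleIntegral, simpleIntegral,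
    Finset.sum_mul_sum]
  · refine Finset.sum_congr rfl fun c _ => Finset.sum_congr rfl fun d _ => ?_
    rw [SimpleFunc.pair_preimage_singleton,
      E.inter' _ _ (s.measurableSet_fiber c) (t.measurableSet_fiber d), smul_mul_smul_comm]
  · intro p _ hp
    have : s.pair t ⁻¹' {p} = ∅ := by
      ext z
      simp only [Set.mem_preimage, Set.mem_singleton_iff, Set.mem_empty_iff_false, iff_false]
      rintro rfl
      exact hp (SimpleFunc.mem_range_self _ z)
    rw [this]; simp

end SpectralMeasure

/-! ### Uniform approximation and bounded Borel functions. -/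

/-- Bounded Borel functions are uniform limits of simple Borel functions. -/
theorem exists_simpleFunc_tendstoUniformly {F : ℂ → ℂ} (hF : Measurable F) {r : ℝ}
    (hr : ∀ z, ‖F z‖ ≤ r) :
    ∃ s : ℕ → SimpleFunc ℂ ℂ, TendstoUniformly (fun n z => s n z) F atTop := by
  -- `g n` rounds down to the grid of mesh `1 / (n + 1)`; it is applied to real and imaginary parts,
  -- and boundedness of `F` makes the range finite.
  let g : ℕ → ℝ → ℝ := fun n x => ⌊(n + 1) * x⌋ / (n + 1)
  have hg : ∀ n, Measurable (g n) := fun n => by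
    have : Measurable fun x : ℝ => ((⌊(n + 1) * x⌋ : ℤ) : ℝ) :=
      measurable_from_top.comp (Int.measurable_floor.comp (measurable_const.mul measurable_id))
    exact this.div_const _
  have hgfin : ∀ n, (g n '' Set.Icc (-r) r).Finite := fun n => by
    refine ((Set.finite_Icc ⌊(n + 1) * (-r)⌋ ⌊(n + 1) * r⌋).image
      (fun k : ℤ => (k : ℝ) / (n + 1))).subset ?_
    rintro _ ⟨x, hx, rfl⟩
    refine ⟨⌊(n + 1) * x⌋, ⟨Int.floor_mono ?_, Int.floor_mono ?_⟩, rfl⟩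
    · exact mul_le_mul_of_nonneg_left hx.1 (by positivity)
    · exact mul_le_mul_of_nonneg_left hx.2 (by positivity)
  have hgapp : ∀ n x, |x - g n x| ≤ 1 / (n + 1 : ℝ) := fun n x => by
    have hn : (0 : ℝ) < n + 1 := by positivity
    have h1 := Int.floor_le ((n + 1) * x)
    have h2 := (Int.lt_floor_add_one ((n + 1) * x)).le
    have : x - g n x = ((n + 1) * x - ⌊(n + 1) * x⌋) / (n + 1) := by
      simp only [g]; field_simp
    rw [this, abs_of_nonneg (div_nonneg (by linarith) hn.le)]
    gcongr
    linarith
  refine ⟨fun n => ⟨fun z => ⟨g n (F z).re, g n (F z).im⟩, fun c => ?_, ?_⟩, ?_⟩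
  · have : Measurable fun z => (⟨g n (F z).re, g n (F z).im⟩ : ℂ) :=
      Complex.measurableEquivRealProd.symm.measurable.comp
        (((hg n).comp (Complex.measurable_re.comp hF)).prodMk
          ((hg n).comp (Complex.measurable_im.comp hF)))
    exact this (measurableSet_singleton c)
  · refine (((hgfin n).prod (hgfin n)).image fun p : ℝ × ℝ => (⟨p.1, p.2⟩ : ℂ)).subset ?_
    rintro _ ⟨z, rfl⟩
    exact ⟨(g n (F z).re, g n (F z).im),
      ⟨⟨_, abs_le.1 ((Complex.abs_re_le_norm _).trans (hr z)), rfl⟩,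
        ⟨_, abs_le.1 ((Complex.abs_im_le_norm _).trans (hr z)), rfl⟩⟩, rfl⟩
  · rw [Metric.tendstoUniformly_iff]
    intro ε hε
    have hlim : Tendsto (fun n : ℕ => 2 * (1 / (n + 1 : ℝ))) atTop (𝓝 0) := by
      simpa using tendsto_one_div_add_atTop_nhds_zero_nat.const_mul (2 : ℝ)
    filter_upwards [hlim.eventually_lt_const hε] with n hn z
    rw [dist_eq_norm]
    refine (Complex.norm_le_abs_re_add_abs_im _).trans_lt (lt_of_le_of_lt ?_ hn)
    rw [two_mul]
    exact add_le_add (hgapp n _) (hgapp n _)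

theorem TendstoUniformly.eventually_norm_le {s : ℕ → ℂ → ℂ} {F : ℂ → ℂ}
    (hs : TendstoUniformly s F atTop) {r : ℝ} (hr : ∀ z, ‖F z‖ ≤ r) {ε : ℝ} (hε : 0 < ε) :
    ∀ᶠ n in atTop, ∀ z, ‖s n z‖ ≤ r + ε := by
  filter_upwards [Metric.tendstoUniformly_iff.1 hs ε hε] with n hn z
  have h1 := hn z
  rw [dist_eq_norm, norm_sub_rev] at h1
  calc ‖s n z‖ = ‖F z + (s n z - F z)‖ := by congr 1; ring
    _ ≤ ‖F z‖ + ‖s n z - F z‖ := norm_add_le _ _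
    _ ≤ r + ε := add_le_add (hr z) h1.le

theorem TendstoUniformly.mul_of_norm_le {s t : ℕ → ℂ → ℂ} {F G : ℂ → ℂ}
    (hs : TendstoUniformly s F atTop) (ht : TendstoUniformly t G atTop) {r q : ℝ}
    (hr : ∀ z, ‖F z‖ ≤ r) (hq : ∀ z, ‖G z‖ ≤ q) :
    TendstoUniformly (fun n z => s n z * t n z) (fun z => F z * G z) atTop := by
  have hr0 : 0 ≤ r := (norm_nonneg _).trans (hr 0)
  have hq0 : 0 ≤ q := (norm_nonneg _).trans (hq 0)
  rw [Metric.tendstoUniformly_iff]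
  intro ε hε
  have hη : 0 < ε / (r + q + 1 + 1) := by positivity
  filter_upwards [Metric.tendstoUniformly_iff.1 hs _ hη, Metric.tendstoUniformly_iff.1 ht _ hη,
    TendstoUniformly.eventually_norm_le ht hq one_pos] with n h1 h2 h3 z
  have h1 := h1 z
  have h2 := h2 z
  rw [dist_eq_norm] at *
  calc ‖F z * G z - s n z * t n z‖ = ‖F z * (G z - t n z) + (F z - s n z) * t n z‖ := by
        congr 1; ring
    _ ≤ ‖F z‖ * ‖G z - t n z‖ + ‖F z - s n z‖ * ‖t n z‖ := by
        refine (norm_add_le _ _).trans ?_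
        rw [norm_mul, norm_mul]
    _ ≤ r * (ε / (r + q + 1 + 1)) + ε / (r + q + 1 + 1) * (q + 1) := by
        gcongr
        · exact hr z
        · exact h3 z
    _ < ε := by
        rw [← sub_pos]
        have : ε - (r * (ε / (r + q + 1 + 1)) + ε / (r + q + 1 + 1) * (q + 1)) =
          ε / (r + q + 1 + 1) := by field_simp; ring
        rw [this]; exact hη

/-- Bounded Borel functions on the complex plane. -/
def IsBoundedBorel (F : ℂ → ℂ) : Prop := Measurable F ∧ ∃ r : ℝ, ∀ z, ‖F z‖ ≤ r

namespace IsBoundedBorel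

variable {F G : ℂ → ℂ}

theorem sub (hF : IsBoundedBorel F) (hG : IsBoundedBorel G) :
    IsBoundedBorel fun z => F z - G z := by
  obtain ⟨hF, r, hr⟩ := hF
  obtain ⟨hG, q, hq⟩ := hG
  exact ⟨hF.sub hG, r + q, fun z => (norm_sub_le _ _).trans (add_le_add (hr z) (hq z))⟩

theorem mul (hF : IsBoundedBorel F) (hG : IsBoundedBorel G) :
    IsBoundedBorel fun z => F z * G z := by
  obtain ⟨hF, r, hr⟩ := hF
  obtain ⟨hG, q, hq⟩ := hG
  refine ⟨hF.mul hG, r * q, fun z => ?_⟩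
  rw [norm_mul]
  exact mul_le_mul (hr z) (hq z) (norm_nonneg _) ((norm_nonneg _).trans (hr z))

theorem indicator {δ : Set ℂ} (hδ : MeasurableSet δ) (hF : Measurable F) {r : ℝ} (hr0 : 0 ≤ r)
    (hr : ∀ z ∈ δ, ‖F z‖ ≤ r) : IsBoundedBorel (δ.indicator F) := by
  refine ⟨hF.indicator hδ, r, fun z => ?_⟩
  by_cases hz : z ∈ δ
  · simpa [hz] using hr z hz
  · simpa [hz] using hr0

end IsBoundedBorel

/-! ### The bounded Borel calculus. -/

namespace SpectralMeasure

variable (E : SpectralMeasure X)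

namespace HasBoundedIntegral

variable {E} {F G : ℂ → ℂ} {T U : X →L[ℂ] X}

theorem sub (hT : E.HasBoundedIntegral F T) (hU : E.HasBoundedIntegral G U) :
    E.HasBoundedIntegral (fun z => F z - G z) (T - U) := by
  obtain ⟨s, hs, hsT⟩ := hT
  obtain ⟨t, ht, htU⟩ := hU
  refine ⟨fun n => s n - t n, hs.sub ht, ?_⟩
  simpa only [simpleIntegral_sub] using hsT.sub htU

theorem mul (hT : E.HasBoundedIntegral F T) (hU : E.HasBoundedIntegral G U)
    (hF : IsBoundedBorel F) (hG : IsBoundedBorel G) :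
    E.HasBoundedIntegral (fun z => F z * G z) (T * U) := by
  obtain ⟨s, hs, hsT⟩ := hT
  obtain ⟨t, ht, htU⟩ := hU
  obtain ⟨-, r, hr⟩ := hF
  obtain ⟨-, q, hq⟩ := hG
  refine ⟨fun n => s n * t n, TendstoUniformly.mul_of_norm_le hs ht hr hq, ?_⟩
  simpa only [simpleIntegral_mul] using hsT.mul htU

theorem norm_le (hT : E.HasBoundedIntegral F T) {M : ℝ}
    (hM : ∀ δ : Set ℂ, MeasurableSet δ → ‖E δ‖ ≤ M) {r : ℝ} (hr : ∀ z, ‖F z‖ ≤ r) :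
    ‖T‖ ≤ 4 * M * r := by
  obtain ⟨s, hs, hsT⟩ := hT
  have hlim : Tendsto (fun ε : ℝ => 4 * M * (r + ε)) (𝓝[>] 0) (𝓝 (4 * M * (r + 0))) :=
    ((continuous_const.mul (continuous_const.add continuous_id)).tendsto 0).mono_left
      nhdsWithin_le_nhds
  rw [add_zero] at hlim
  refine ge_of_tendsto hlim (eventually_nhdsWithin_of_forall fun ε hε => ?_)
  refine le_of_tendsto hsT.norm ?_
  filter_upwards [TendstoUniformly.eventually_norm_le hs hr hε] with n hn
  exact E.norm_simpleIntegral_le hM _ hn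

/-- The difference integrates the zero function, so the norm bound with `r = 0` applies. This makes
the choice in `boundedIntegral` immaterial. -/
theorem unique [CompleteSpace X] (hT : E.HasBoundedIntegral F T)
    (hU : E.HasBoundedIntegral F U) : T = U := by
  obtain ⟨M, -, hM⟩ := E.exists_norm_le
  have h := (hT.sub hU).norm_le hM (r := 0) (by simp)
  rw [mul_zero] at h
  exact sub_eq_zero.1 (norm_le_zero_iff.1 h)

end HasBoundedIntegral

variable [CompleteSpace X] {F G : ℂ → ℂ}

theorem exists_hasBoundedIntegral (hF : IsBoundedBorel F) : ∃ T, E.HasBoundedIntegral F T := by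
  obtain ⟨M, hM1, hM⟩ := E.exists_norm_le
  obtain ⟨hF, r, hr⟩ := hF
  obtain ⟨s, hs⟩ := exists_simpleFunc_tendstoUniformly hF hr
  have hc : CauchySeq fun n => E.simpleIntegral (s n) := by
    rw [Metric.cauchySeq_iff]
    intro ε hε
    -- Two approximants differ by at most `2η`, so their integrals differ by at most `8 * M * η = ε
    -- / 2`.
    have hη : 0 < ε / (16 * M) := by positivity
    obtain ⟨N, hN⟩ := eventually_atTop.1 (Metric.tendstoUniformly_iff.1 hs _ hη)
    refine ⟨N, fun m hm n hn => ?_⟩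
    rw [dist_eq_norm, ← simpleIntegral_sub]
    refine (E.norm_simpleIntegral_le hM _ (r := 2 * (ε / (16 * M))) fun z => ?_).trans_lt ?_
    · rw [SimpleFunc.coe_sub, Pi.sub_apply, ← dist_eq_norm, two_mul]
      refine (dist_triangle_left _ _ (F z)).trans (add_le_add (hN m hm z).le (hN n hn z).le)
    · have : 4 * M * (2 * (ε / (16 * M))) = ε / 2 := by field_simp; ring
      rw [this]; exact half_lt_self hε
  obtain ⟨T, hT⟩ := cauchySeq_tendsto_of_complete hc
  exact ⟨T, s, hs, hT⟩

theorem hasBoundedIntegral_boundedIntegral (hF : IsBoundedBorel F) :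
    E.HasBoundedIntegral F (E.boundedIntegral F) := by
  have h := E.exists_hasBoundedIntegral hF
  rw [boundedIntegral, dif_pos h]
  exact Classical.choose_spec h

theorem HasBoundedIntegral.boundedIntegral_eq {E : SpectralMeasure X} {T : X →L[ℂ] X}
    (hT : E.HasBoundedIntegral F T) : E.boundedIntegral F = T := by
  have h : ∃ T, E.HasBoundedIntegral F T := ⟨T, hT⟩
  rw [boundedIntegral, dif_pos h]
  exact (Classical.choose_spec h).unique hT

theorem boundedIntegral_sub (hF : IsBoundedBorel F) (hG : IsBoundedBorel G) :
    E.boundedIntegral (fun z => F z - G z) = E.boundedIntegral F - E.boundedIntegral G :=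
  ((E.hasBoundedIntegral_boundedIntegral hF).sub
    (E.hasBoundedIntegral_boundedIntegral hG)).boundedIntegral_eq

theorem boundedIntegral_mul (hF : IsBoundedBorel F) (hG : IsBoundedBorel G) :
    E.boundedIntegral (fun z => F z * G z) = E.boundedIntegral F * E.boundedIntegral G :=
  ((E.hasBoundedIntegral_boundedIntegral hF).mul
    (E.hasBoundedIntegral_boundedIntegral hG) hF hG).boundedIntegral_eq

theorem norm_boundedIntegral_le (hF : Measurable F) {M : ℝ}
    (hM : ∀ δ : Set ℂ, MeasurableSet δ → ‖E δ‖ ≤ M) {r : ℝ} (hr : ∀ z, ‖F z‖ ≤ r) :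
    ‖E.boundedIntegral F‖ ≤ 4 * M * r :=
  (E.hasBoundedIntegral_boundedIntegral ⟨hF, r, hr⟩).norm_le hM hr

theorem boundedIntegral_const_indicator {δ : Set ℂ} (hδ : MeasurableSet δ) (c : ℂ) :
    E.boundedIntegral (δ.indicator fun _ => c) = c • E δ := by
  refine HasBoundedIntegral.boundedIntegral_eq
    ⟨fun _ => SimpleFunc.piecewise δ hδ (SimpleFunc.const ℂ c) (SimpleFunc.const ℂ 0), ?_, ?_⟩
  · have : (fun z => SimpleFunc.piecewise δ hδ (SimpleFunc.const ℂ c) (SimpleFunc.const ℂ 0) z) =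
        δ.indicator fun _ => c := by
      ext z; simp [Set.indicator, Set.piecewise]
    rw [← this]
    exact Metric.tendstoUniformly_iff.2 fun ε hε => Eventually.of_forall fun _ _ => by simpa using hε
  · simp only [simpleIntegral_eq_setToSimpleFunc]
    rw [SimpleFunc.setToSimpleFunc_indicator]
    · simp [smulRightFun]
    · ext1; simp [smulRightFun]

theorem proj_mul_boundedIntegral {δ : Set ℂ} (hδ : MeasurableSet δ) (hF : IsBoundedBorel F) :
    E δ * E.boundedIntegral F = E.boundedIntegral (δ.indicator F) := by
  have h1 := E.boundedIntegral_const_indicator hδ 1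
  rw [one_smul] at h1
  rw [← h1, ← E.boundedIntegral_mul (IsBoundedBorel.indicator hδ measurable_const zero_le_one
    (by simp)) hF]
  congr 1
  ext z
  by_cases hz : z ∈ δ <;> simp [hz]

theorem boundedIntegral_mul_comm (hF : IsBoundedBorel F) (hG : IsBoundedBorel G) :
    E.boundedIntegral F * E.boundedIntegral G = E.boundedIntegral G * E.boundedIntegral F := by
  rw [← E.boundedIntegral_mul hF hG, ← E.boundedIntegral_mul hG hF]
  simp_rw [mul_comm]

theorem boundedIntegral_mul_proj {δ : Set ℂ} (hδ : MeasurableSet δ) (hF : IsBoundedBorel F) :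
    E.boundedIntegral F * E δ = E.boundedIntegral (δ.indicator F) := by
  have h1 := E.boundedIntegral_const_indicator hδ 1
  rw [one_smul] at h1
  rw [← E.proj_mul_boundedIntegral hδ hF, ← h1, E.boundedIntegral_mul_comm hF
    (IsBoundedBorel.indicator hδ measurable_const zero_le_one (by simp))]

end SpectralMeasure

/-! ### Strong limits; measurability of the spectrum. -/

theorem strongLimit_eq_iff {ι : Type*} {l : Filter ι} [l.NeBot] {T : ι → X →L[ℂ] X} {x y : X} :
    (∃ h : x ∈ (strongLimit l T).domain, strongLimit l T ⟨x, h⟩ = y) ↔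
      Tendsto (fun i => T i x) l (𝓝 y) := by
  constructor
  · rintro ⟨h, rfl⟩
    exact tendsto_strongLimit ⟨x, h⟩
  · exact fun h => ⟨⟨y, h⟩, tendsto_nhds_unique (tendsto_strongLimit ⟨x, ⟨y, h⟩⟩) h⟩

theorem strongLimit_congr {ι κ : Type*} {l : Filter ι} [l.NeBot] {k : Filter κ} [k.NeBot]
    {T : ι → X →L[ℂ] X} {S : κ → X →L[ℂ] X}
    (h : ∀ x y, Tendsto (fun i => T i x) l (𝓝 y) ↔ Tendsto (fun i => S i x) k (𝓝 y)) :
    strongLimit l T = strongLimit k S := by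
  refine LinearPMap.ext (Submodule.ext fun x => exists_congr fun y => h x y) ?_
  intro x hx hx'
  exact tendsto_nhds_unique ((h _ _).1 (tendsto_strongLimit ⟨x, hx⟩)) (tendsto_strongLimit ⟨x, hx'⟩)

/-- Neumann series: `A - w = (1 - (w - z) R)(A - z)`, so the inverse at nearby `w` is `R (1 - (w -
z) R)⁻¹`. -/
theorem isOpen_setOf_isResolventPoint [CompleteSpace X] (A : X →ₗ.[ℂ] X) :
    IsOpen {z | IsResolventPoint A z} := by
  rw [Metric.isOpen_iff]
  rintro z ⟨R, hR1, hR2⟩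
  refine ⟨(‖R‖ + 1)⁻¹, by positivity, fun w hw => ?_⟩
  have hlt : ‖(w - z) • R‖ < 1 := by
    rw [norm_smul, ← dist_eq_norm]
    calc dist w z * ‖R‖ ≤ (‖R‖ + 1)⁻¹ * ‖R‖ := by gcongr; exact (Metric.mem_ball.1 hw).le
      _ < 1 := by rw [inv_mul_lt_one₀ (by positivity)]; linarith
  obtain ⟨V, hV⟩ := isUnit_one_sub_of_norm_lt_one hlt
  have h1 : ∀ u, (V : X →L[ℂ] X) u = u - (w - z) • R u := fun u => by rw [hV]; rfl
  have hVi : ∀ u, (V : X →L[ℂ] X) ((↑V⁻¹ : X →L[ℂ] X) u) = u := fun u => by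
    rw [← mul_apply_eq_comp, Units.mul_inv]; rfl
  have hiV : ∀ u, (↑V⁻¹ : X →L[ℂ] X) ((V : X →L[ℂ] X) u) = u := fun u => by
    rw [← mul_apply_eq_comp, Units.inv_mul]; rfl
  refine ⟨R * ↑V⁻¹, fun y => ?_, fun x => ?_⟩
  · obtain ⟨h, hh⟩ := hR1 ((↑V⁻¹ : X →L[ℂ] X) y)
    refine ⟨h, ?_⟩
    have h2 : (↑V⁻¹ : X →L[ℂ] X) y - (w - z) • R ((↑V⁻¹ : X →L[ℂ] X) y) = y := by rw [← h1, hVi]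
    change A ⟨R ((↑V⁻¹ : X →L[ℂ] X) y), h⟩ - w • R ((↑V⁻¹ : X →L[ℂ] X) y) = y
    refine Eq.trans ?_ h2
    nth_rewrite 3 [← hh]
    rw [sub_smul]
    abel
  · have h2 := hR2 x
    rw [mul_apply_eq_comp]
    have h3 : A x - w • (x : X) = (V : X →L[ℂ] X) (A x - z • (x : X)) := by
      rw [h1, h2, sub_smul]; abel
    rw [h3, hiV, h2]

theorem measurableSet_spectrum [CompleteSpace X] (A : X →ₗ.[ℂ] X) : MeasurableSet (spectrum A) :=
  (isOpen_setOf_isResolventPoint A).measurableSet.compl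

/-! ### The spectral measure is carried by the spectrum. -/

namespace SpectralMeasure

variable (E : SpectralMeasure X)

/-- The closed disk of radius `n` about the origin. -/
def disk (n : ℕ) : Set ℂ := {z | ‖z‖ ≤ n}

theorem measurableSet_disk (n : ℕ) : MeasurableSet (disk n) :=
  measurableSet_le measurable_norm measurable_const

theorem disk_mono {m n : ℕ} (h : m ≤ n) : disk m ⊆ disk n := fun _ hz =>
  le_trans (show ‖_‖ ≤ (m : ℝ) from hz) (Nat.cast_le.2 h)

theorem iUnion_disk : ⋃ n, disk n = Set.univ :=
  Set.eq_univ_of_forall fun z => Set.mem_iUnion.2 (exists_nat_ge ‖z‖)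

theorem tendsto_proj_disk (x : X) : Tendsto (fun n => E (disk n) x) atTop (𝓝 x) := by
  have := E.tendsto_apply_iUnion measurableSet_disk (fun _ _ h => disk_mono h) x
  rwa [iUnion_disk, E.univ'] at this

theorem isBoundedBorel_truncation {F : ℂ → ℂ} (hF : Measurable F) (n : ℕ) :
    IsBoundedBorel (truncation F n) :=
  IsBoundedBorel.indicator (measurableSet_le hF.norm measurable_const) hF n.cast_nonneg
    fun _ hz => hz

/-- The bounded operator `∫_{|λ| ≤ n} λ dE(λ)`. -/
def idTrunc (n : ℕ) : X →L[ℂ] X := E.boundedIntegral (truncation (fun z => z) n)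

variable [CompleteSpace X]

theorem idTrunc_mul_proj {δ : Set ℂ} (hδ : MeasurableSet δ) {n : ℕ} (h : δ ⊆ disk n) :
    E.idTrunc n * E δ = E.boundedIntegral (δ.indicator fun z => z) := by
  rw [idTrunc, E.boundedIntegral_mul_proj hδ (isBoundedBorel_truncation measurable_id' n)]
  congr 1
  exact (Set.indicator_indicator _ _ _).trans (congrArg (Set.indicator · _) (Set.inter_eq_left.2 h))

theorem tendsto_idTrunc_proj {δ : Set ℂ} (hδ : MeasurableSet δ) {N : ℕ} (h : δ ⊆ disk N) (x : X) :
    Tendsto (fun n => E.idTrunc n (E δ x)) atTop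
      (𝓝 (E.boundedIntegral (δ.indicator fun z => z) x)) := by
  refine tendsto_const_nhds.congr' ?_
  filter_upwards [eventually_ge_atTop N] with n hn
  rw [← E.idTrunc_mul_proj hδ (h.trans (disk_mono hn))]
  rfl

/-- Every point of the resolvent set has a neighbourhood on which the spectral measure vanishes. -/
theorem exists_ball_eq_zero {z : ℂ} (hz : IsResolventPoint (E.integral fun z => z) z) :
    ∃ r > 0, E (Metric.ball z r) = 0 := by
  obtain ⟨M, hM1, hM⟩ := E.exists_norm_le
  obtain ⟨R, -, hR⟩ := hz
  -- On the range of `E δ`, `A - z` has norm at most `4 * M * r`, while `R` inverts it on the left.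
  -- This radius makes `‖R‖ * (4 * M * r) < 1`, which forces `E δ = 0`.
  have hr : 0 < (4 * M * (‖R‖ + 1))⁻¹ := by positivity
  refine ⟨_, hr, ?_⟩
  set r := (4 * M * (‖R‖ + 1))⁻¹ with hrdef
  set δ := Metric.ball z r
  have hδ : MeasurableSet δ := Metric.isOpen_ball.measurableSet
  obtain ⟨N, hN⟩ := exists_nat_ge (‖z‖ + r)
  have hδN : δ ⊆ disk N := fun w hw => by
    have h1 : ‖w - z‖ < r := by rw [← dist_eq_norm]; exact hw
    have h2 := norm_le_norm_add_norm_sub' w z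
    exact (show ‖w‖ ≤ N by linarith)
  ext x
  obtain ⟨hdom, hval⟩ := strongLimit_eq_iff.2 (E.tendsto_idTrunc_proj hδ hδN x)
  have hu := hR ⟨E δ x, hdom⟩
  rw [show E.integral (fun z => z) ⟨E δ x, hdom⟩ = _ from hval] at hu
  have hid : IsBoundedBorel (δ.indicator fun w => w) :=
    IsBoundedBorel.indicator hδ measurable_id N.cast_nonneg fun w hw => hδN hw
  have hcz : IsBoundedBorel (δ.indicator fun _ => z) :=
    IsBoundedBorel.indicator hδ measurable_const (norm_nonneg z) fun _ _ => le_rfl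
  have hG := hid.sub hcz
  set G : ℂ → ℂ := fun w => δ.indicator (fun w => w) w - δ.indicator (fun _ => z) w with hGdef
  have hΦ : E.boundedIntegral G = E.boundedIntegral (δ.indicator fun w => w) - z • E δ := by
    rw [E.boundedIntegral_sub hid hcz, E.boundedIntegral_const_indicator hδ]
  have hnorm : ‖E.boundedIntegral G‖ ≤ 4 * M * r := by
    refine E.norm_boundedIntegral_le hG.1 hM fun w => ?_
    by_cases hw : w ∈ δ
    · simpa [hGdef, hw, ← dist_eq_norm] using (Metric.mem_ball.1 hw).le
    · simpa [hGdef, hw] using hr.le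
  have hGE : E.boundedIntegral G * E δ = E.boundedIntegral G := by
    rw [E.boundedIntegral_mul_proj hδ hG]
    congr 1
    ext w
    by_cases hw : w ∈ δ <;> simp [hGdef, hw]
  have hu2 : R (E.boundedIntegral G (E δ x)) = E δ x := by
    rw [← mul_apply_eq_comp (E.boundedIntegral G), hGE, hΦ]
    exact hu
  have hle : ‖E δ x‖ ≤ ‖R‖ * (4 * M * r * ‖E δ x‖) := by
    conv_lhs => rw [← hu2]
    refine (R.le_opNorm _).trans ?_
    gcongr
    exact (ContinuousLinearMap.le_opNorm _ _).trans (by gcongr)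
  have hone : 4 * M * (‖R‖ + 1) * r = 1 := mul_inv_cancel₀ (by positivity)
  have hle2 : 4 * M * r * ‖E δ x‖ ≤ 0 := by
    have : ‖E δ x‖ = 4 * M * (‖R‖ + 1) * r * ‖E δ x‖ := by rw [hone, one_mul]
    nlinarith
  have hpos : 0 < 4 * M * r := by positivity
  exact norm_le_zero_iff.1 (nonpos_of_mul_nonpos_right hle2 hpos)

/-- Countably many null balls cover the resolvent set by the Lindelöf property. -/
theorem proj_spectrum : E (spectrum (E.integral fun z => z)) = 1 := by
  set S := spectrum (E.integral fun z => z)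
  have hS : MeasurableSet S := measurableSet_spectrum _
  have hc : E Sᶜ = 0 := by
    have hx : ∀ z ∈ Sᶜ, ∃ r > 0, E (Metric.ball z r) = 0 := fun z hz =>
      E.exists_ball_eq_zero (not_not.1 hz)
    choose! r hr0 hr using hx
    obtain ⟨t, htS, ht, hcov⟩ := TopologicalSpace.countable_cover_nhdsWithin
      (f := fun z => Metric.ball z (r z)) (s := Sᶜ)
      fun z hz => mem_nhdsWithin_of_mem_nhds (Metric.ball_mem_nhds z (hr0 z hz))
    rcases t.eq_empty_or_nonempty with rfl | hne
    · have : Sᶜ = ∅ := by simpa using hcov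
      rw [this, apply_empty]
    · obtain ⟨f, rfl⟩ := ht.exists_eq_range hne
      have hb : ∀ n, MeasurableSet (Metric.ball (f n) (r (f n))) := fun n =>
        Metric.isOpen_ball.measurableSet
      have h0 := E.apply_iUnion_eq_zero hb fun n => hr _ (htS (Set.mem_range_self n))
      rw [Set.biUnion_range] at hcov
      rw [← Set.inter_eq_left.2 hcov, E.inter' _ _ hS.compl (MeasurableSet.iUnion hb), h0, mul_zero]
  have h := E.apply_union hS hS.compl disjoint_compl_right
  rw [Set.union_compl_self, E.univ', hc, add_zero] at h
  exact h.symm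

end SpectralMeasure

/-! ### Estimates for `e^w` and `(e^w - 1)/w`. -/

theorem norm_exp_sub_one_le_of_re_eq_zero {w : ℂ} (hw : w.re = 0) : ‖Complex.exp w - 1‖ ≤ ‖w‖ := by
  have h : w = Complex.I * (w.im : ℂ) := by
    apply Complex.ext <;> simp [hw]
  have h2 := Real.norm_exp_I_mul_ofReal_sub_one_le (x := w.im)
  rw [← h] at h2
  refine h2.trans ?_
  exact Complex.abs_im_le_norm w

theorem mul_dslope_exp (w : ℂ) : w * dslope Complex.exp 0 w = Complex.exp w - 1 := by
  have := sub_smul_dslope Complex.exp 0 w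
  simpa using this

theorem measurable_dslope_exp : Measurable (dslope Complex.exp 0) := by
  refine Continuous.measurable (continuousOn_univ.1 ?_)
  exact (continuousOn_dslope univ_mem).2
    ⟨Complex.continuous_exp.continuousOn, Complex.differentiable_exp 0⟩

theorem norm_dslope_exp_le {w : ℂ} (hw : w.re = 0) : ‖dslope Complex.exp 0 w‖ ≤ 1 := by
  rcases eq_or_ne w 0 with rfl | h0
  · simp
  · have h := norm_exp_sub_one_le_of_re_eq_zero hw
    rw [← mul_dslope_exp, norm_mul] at h
    exact le_of_mul_le_mul_left (by simpa using h) (norm_pos_iff.2 h0)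

theorem norm_dslope_exp_sub_one_le {w : ℂ} (hw : ‖w‖ ≤ 1) :
    ‖dslope Complex.exp 0 w - 1‖ ≤ ‖w‖ := by
  rcases eq_or_ne w 0 with rfl | h0
  · simp
  · have h := Complex.norm_exp_sub_one_sub_id_le hw
    rw [← mul_dslope_exp, ← mul_sub_one, norm_mul, sq] at h
    exact le_of_mul_le_mul_left h (norm_pos_iff.2 h0)

/-! ### Bounded convergence, the exponential group and its generator. -/

namespace SpectralMeasure

variable (E : SpectralMeasure X) [CompleteSpace X]

/-- Bounded convergence, for convergence that is uniform on bounded sets. -/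
theorem tendsto_boundedIntegral {ι : Type*} {l : Filter ι} {F : ι → ℂ → ℂ} {G : ℂ → ℂ} {r : ℝ}
    (hF : ∀ i, Measurable (F i)) (hG : Measurable G) (hFr : ∀ i z, ‖F i z‖ ≤ r)
    (hGr : ∀ z, ‖G z‖ ≤ r) (h : ∀ N, TendstoUniformlyOn F G l (disk N)) (x : X) :
    Tendsto (fun i => E.boundedIntegral (F i) x) l (𝓝 (E.boundedIntegral G x)) := by
  obtain ⟨M, hM1, hM⟩ := E.exists_norm_le
  have hr0 : 0 ≤ r := (norm_nonneg _).trans (hGr 0)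
  rw [Metric.tendsto_nhds]
  intro ε hε
  have hη : 0 < ε / 2 / (8 * M * r + 1) := by positivity
  -- Split `x` into `E (disk N) x` and a remainder. The remainder is small and meets an operator of
  -- norm at most `8 * M * r`; on the disk the integrands are uniformly close.
  obtain ⟨N, hN⟩ := (Metric.tendsto_nhds.1 (E.tendsto_proj_disk x) _ hη).exists
  rw [dist_comm, dist_eq_norm] at hN
  have hη' : 0 < ε / 2 / (4 * M * (‖x‖ + 1)) := by positivity
  filter_upwards [Metric.tendstoUniformlyOn_iff.1 (h N) _ hη'] with i hi
  have hFi : IsBoundedBorel (F i) := ⟨hF i, r, hFr i⟩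
  have hGb : IsBoundedBorel G := ⟨hG, r, hGr⟩
  have hsub := hFi.sub hGb
  have hs1 : ‖E.boundedIntegral (fun z => F i z - G z)‖ ≤ 4 * M * (r + r) :=
    E.norm_boundedIntegral_le hsub.1 hM fun z => (norm_sub_le _ _).trans
      (add_le_add (hFr i z) (hGr z))
  have hs2 : ‖E.boundedIntegral (fun z => F i z - G z) * E (disk N)‖ ≤
      4 * M * (ε / 2 / (4 * M * (‖x‖ + 1))) := by
    rw [E.boundedIntegral_mul_proj (measurableSet_disk N) hsub]
    refine E.norm_boundedIntegral_le (hsub.1.indicator (measurableSet_disk N)) hM fun z => ?_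
    by_cases hz : z ∈ disk N
    · have := hi z hz
      rw [dist_comm, dist_eq_norm] at this
      simpa [hz] using this.le
    · simpa [hz] using hη'.le
  have hdecomp : E.boundedIntegral (F i) x - E.boundedIntegral G x =
      E.boundedIntegral (fun z => F i z - G z) (x - E (disk N) x) +
        (E.boundedIntegral (fun z => F i z - G z) * E (disk N)) x := by
    rw [mul_apply_eq_comp, ← map_add, sub_add_cancel, E.boundedIntegral_sub hFi hGb]
    rfl
  rw [dist_eq_norm, hdecomp]
  have h1 : ‖E.boundedIntegral (fun z => F i z - G z) (x - E (disk N) x)‖ <ε / 2 := by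
    calc _ ≤ 4 * M * (r + r) * (ε / 2 / (8 * M * r + 1)) :=
          (ContinuousLinearMap.le_opNorm _ _).trans (by gcongr)
      _ = (8 * M * r) / (8 * M * r + 1) * (ε / 2) := by ring
      _ < 1 * (ε / 2) := by
          gcongr
          rw [div_lt_one (by positivity)]; linarith
      _ = ε / 2 := one_mul _
  have h2 : ‖(E.boundedIntegral (fun z => F i z - G z) * E (disk N)) x‖ ≤ ε / 2 := by
    calc _ ≤ 4 * M * (ε / 2 / (4 * M * (‖x‖ + 1))) * ‖x‖ :=
          (ContinuousLinearMap.le_opNorm _ _).trans (by gcongr)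
      _ = ‖x‖ / (‖x‖ + 1) * (ε / 2) := by field_simp
      _ ≤ 1 * (ε / 2) := by
          gcongr
          rw [div_le_one (by positivity)]; linarith
      _ = ε / 2 := one_mul _
  exact (norm_add_le _ _).trans_lt (by linarith)

variable {S : Set ℂ}

/-- The function `λ ↦ e^{tλ}` on `S`, extended by `0`. -/
def expOn (S : Set ℂ) (t : ℝ) : ℂ → ℂ := S.indicator fun z => Complex.exp (t * z)

/-- The function `λ ↦ (e^{tλ} - 1) / (tλ)` on `S`, extended by `0`. -/
def expQuotient (S : Set ℂ) (t : ℝ) : ℂ → ℂ := S.indicator fun z => dslope Complex.exp 0 (t * z)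

theorem measurable_expOn (hS : MeasurableSet S) (t : ℝ) : Measurable (expOn S t) :=
  Measurable.indicator (by fun_prop) hS

theorem measurable_expQuotient (hS : MeasurableSet S) (t : ℝ) : Measurable (expQuotient S t) :=
  (measurable_dslope_exp.comp (measurable_const.mul measurable_id)).indicator hS

theorem re_ofReal_mul_eq_zero {z : ℂ} (hz : z.re = 0) (t : ℝ) : ((t : ℂ) * z).re = 0 := by
  simp [hz]

theorem norm_expOn_le (hre : S ⊆ {z : ℂ | z.re = 0}) (t : ℝ) (z : ℂ) : ‖expOn S t z‖ ≤ 1 := by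
  by_cases hz : z ∈ S
  · have : z.re = 0 := hre hz
    simp [expOn, hz, Complex.norm_exp, this]
  · simp [expOn, hz]

theorem norm_expQuotient_le (hre : S ⊆ {z : ℂ | z.re = 0}) (t : ℝ) (z : ℂ) :
    ‖expQuotient S t z‖ ≤ 1 := by
  by_cases hz : z ∈ S
  · simpa [expQuotient, hz] using norm_dslope_exp_le (re_ofReal_mul_eq_zero (hre hz) t)
  · simp [expQuotient, hz]

theorem tendstoUniformlyOn_expOn (hre : S ⊆ {z : ℂ | z.re = 0}) (N : ℕ) :
    TendstoUniformlyOn (expOn S) (expOn S 0) (𝓝 0) (disk N) := by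
  rw [Metric.tendstoUniformlyOn_iff]
  intro ε hε
  have hlim : Tendsto (fun t : ℝ => |t| * N) (𝓝 0) (𝓝 0) := by
    simpa using (show Continuous fun t : ℝ => |t| * N by fun_prop).tendsto 0
  filter_upwards [hlim.eventually_lt_const hε] with t ht z hz
  refine lt_of_le_of_lt ?_ ht
  rw [dist_comm, dist_eq_norm]
  by_cases hzS : z ∈ S
  · have h := norm_exp_sub_one_le_of_re_eq_zero (re_ofReal_mul_eq_zero (hre hzS) t)
    rw [norm_mul, Complex.norm_real, Real.norm_eq_abs] at h
    have h2 : |t| * ‖z‖ ≤ |t| * N := by gcongr; exact hz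
    simpa [expOn, hzS] using h.trans h2
  · simpa [expOn, hzS] using by positivity

theorem tendstoUniformlyOn_expQuotient (N : ℕ) :
    TendstoUniformlyOn (expQuotient S) (S.indicator fun _ => 1) (𝓝 0) (disk N) := by
  rw [Metric.tendstoUniformlyOn_iff]
  intro ε hε
  have hlim : Tendsto (fun t : ℝ => |t| * N) (𝓝 0) (𝓝 0) := by
    simpa using (show Continuous fun t : ℝ => |t| * N by fun_prop).tendsto 0
  filter_upwards [hlim.eventually_lt_const hε, hlim.eventually_lt_const one_pos] with t ht ht1 z hz
  refine lt_of_le_of_lt ?_ ht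
  rw [dist_comm, dist_eq_norm]
  by_cases hzS : z ∈ S
  · have h2 : ‖(t : ℂ) * z‖ ≤ |t| * N := by
      rw [norm_mul, Complex.norm_real, Real.norm_eq_abs]; gcongr; exact hz
    simpa [expQuotient, hzS] using (norm_dslope_exp_sub_one_le (h2.trans ht1.le)).trans h2
  · simpa [expQuotient, hzS] using by positivity

/-- The operators `∫_S e^{tλ} dE(λ)`. -/
def expGroup (S : Set ℂ) (t : ℝ) : X →L[ℂ] X := E.boundedIntegral (expOn S t)

section

variable (hS : MeasurableSet S) (hre : S ⊆ {z : ℂ | z.re = 0}) (hES : E S = 1)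

include hS hre

theorem norm_expGroup_le {M : ℝ} (hM : ∀ δ : Set ℂ, MeasurableSet δ → ‖E δ‖ ≤ M) (t : ℝ) :
    ‖E.expGroup S t‖ ≤ 4 * M := by
  simpa [expGroup] using E.norm_boundedIntegral_le (measurable_expOn hS t) hM (norm_expOn_le hre t)

theorem isBoundedBorel_expOn (t : ℝ) : IsBoundedBorel (expOn S t) :=
  ⟨measurable_expOn hS t, 1, norm_expOn_le hre t⟩

theorem isBoundedBorel_expQuotient (t : ℝ) : IsBoundedBorel (expQuotient S t) :=
  ⟨measurable_expQuotient hS t, 1, norm_expQuotient_le hre t⟩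

include hES

theorem isStronglyContinuousGroup_expGroup : IsStronglyContinuousGroup (E.expGroup S) := by
  have h0 : E.expGroup S 0 = 1 := by
    have h := E.boundedIntegral_const_indicator hS 1
    rw [one_smul, hES] at h
    rw [← h, expGroup]
    congr 1
    ext z
    simp [expOn]
  have hadd : ∀ s t : ℝ, E.expGroup S (s + t) = E.expGroup S s * E.expGroup S t := fun s t => by
    rw [expGroup, expGroup, expGroup, ← E.boundedIntegral_mul (isBoundedBorel_expOn hS hre s)
      (isBoundedBorel_expOn hS hre t)]
    congr 1
    ext z
    by_cases hz : z ∈ S <;> simp [expOn, hz, add_mul, Complex.exp_add]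
  refine ⟨h0, hadd, fun x => continuous_iff_continuousAt.2 fun t => ?_⟩
  have h1 : Tendsto (fun s => E.expGroup S s x) (𝓝 0) (𝓝 (E.expGroup S 0 x)) :=
    E.tendsto_boundedIntegral (measurable_expOn hS) (measurable_expOn hS 0) (norm_expOn_le hre)
      (norm_expOn_le hre 0) (tendstoUniformlyOn_expOn hre) x
  have h2 : Tendsto (fun s => s - t) (𝓝 t) (𝓝 0) := by
    simpa using (continuous_sub_right t).tendsto t
  have h3 := ((E.expGroup S t).continuous.tendsto _).comp (h1.comp h2)
  rw [h0] at h3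
  refine h3.congr fun s => ?_
  rw [Function.comp_apply, Function.comp_apply, ← mul_apply_eq_comp, ← hadd, add_sub_cancel]

theorem expGroup_sub_one_mul_proj_disk (t : ℝ) (n : ℕ) :
    (E.expGroup S t - 1) * E (disk n) = (t : ℂ) • (E.boundedIntegral (expQuotient S t) * E.idTrunc n) := by
  have hD := measurableSet_disk n
  have hone := E.boundedIntegral_const_indicator hS 1
  rw [one_smul, hES] at hone
  have hbone : IsBoundedBorel (S.indicator fun _ => (1 : ℂ)) :=
    IsBoundedBorel.indicator hS measurable_const zero_le_one (by simp)
  have hexp := isBoundedBorel_expOn hS hre t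
  have hq := isBoundedBorel_expQuotient hS hre t
  have hid : IsBoundedBorel (truncation (fun z => z) n) := isBoundedBorel_truncation measurable_id' n
  have ht := E.boundedIntegral_const_indicator hD (t : ℂ)
  have hbt : IsBoundedBorel ((disk n).indicator fun _ => (t : ℂ)) :=
    IsBoundedBorel.indicator hD measurable_const (norm_nonneg _) fun _ _ => le_rfl
  have hidD : E.idTrunc n * E (disk n) = E.idTrunc n := E.idTrunc_mul_proj hD le_rfl
  -- The scalar `t` is absorbed as `∫ t 1_{disk n} dE`, so the claim becomes a pointwise identity of
  -- integrands.
  rw [← hidD, ← mul_assoc, ← mul_smul_comm, ← ht, idTrunc, expGroup, ← hone,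
    ← E.boundedIntegral_sub hexp hbone, E.boundedIntegral_mul_proj hD (hexp.sub hbone),
    ← E.boundedIntegral_mul hq hid, ← E.boundedIntegral_mul (hq.mul hid) hbt]
  congr 1
  ext z
  by_cases hz : z ∈ disk n
  · by_cases hzS : z ∈ S
    · have h := mul_dslope_exp (t * z)
      have hz' : ‖z‖ ≤ n := hz
      simp only [Set.indicator_of_mem hz, expOn, expQuotient, truncation, Set.indicator_of_mem hzS,
        ← h]
      rw [Set.indicator_of_mem (by exact hz')]
      ring
    · simp [hz, hzS, expOn, expQuotient]
  · simp [hz]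

/-- Let `Q_t = ∫ q(tλ) dE`, `A_n = idTrunc n` and `E_n = E (disk n)`; then `t⁻¹ (T_t - 1) E_n x =
Q_t A_n x`. If the difference quotients of `x` tend to `y`, letting `t → 0` gives `E_n y = A_n x`,
whence `A_n x → y`. If `A_n x → y`, letting `n → ∞` gives `t⁻¹ (T_t - 1) x = Q_t y`, which tends to
`y`. -/
theorem generator_expGroup : generator (E.expGroup S) = E.integral fun z => z := by
  have hquot : ∀ y, Tendsto (fun t => E.boundedIntegral (expQuotient S t) y) (𝓝[≠] 0) (𝓝 y) := by
    intro y
    have h := E.tendsto_boundedIntegral (measurable_expQuotient hS) (G := S.indicator fun _ => 1)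
      (measurable_const.indicator hS) (norm_expQuotient_le hre)
      (fun z => by by_cases hz : z ∈ S <;> simp [hz]) tendstoUniformlyOn_expQuotient y
    rw [E.boundedIntegral_const_indicator hS, one_smul, hES] at h
    exact h.mono_left nhdsWithin_le_nhds
  have hkey : ∀ (n : ℕ) (x : X), ∀ t : ℝ, t ≠ 0 →
      ((t : ℂ)⁻¹ • (E.expGroup S t - 1)) (E (disk n) x) =
        E.boundedIntegral (expQuotient S t) (E.idTrunc n x) := fun n x t ht => by
    have h := DFunLike.congr_fun (E.expGroup_sub_one_mul_proj_disk hS hre hES t n) x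
    rw [mul_apply_eq_comp] at h
    rw [smul_apply, h, smul_apply, inv_smul_smul₀ (by exact_mod_cast ht)]
    rfl
  refine strongLimit_congr fun x y => ⟨fun h => ?_, fun h => ?_⟩
  · refine (E.tendsto_proj_disk y).congr fun n => ?_
    refine tendsto_nhds_unique (((E (disk n)).continuous.tendsto y).comp h) ?_
    refine (hquot (E.idTrunc n x)).congr' (eventually_nhdsWithin_of_forall fun t ht => ?_)
    rw [← hkey n x t ht, Function.comp_apply, ← mul_apply_eq_comp, ← mul_apply_eq_comp]
    congr 1
    rw [smul_mul_assoc, mul_smul_comm, sub_mul, mul_sub, one_mul, mul_one, expGroup,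
      E.boundedIntegral_mul_proj (measurableSet_disk n) (isBoundedBorel_expOn hS hre t),
      E.proj_mul_boundedIntegral (measurableSet_disk n) (isBoundedBorel_expOn hS hre t)]
  · refine (hquot y).congr' (eventually_nhdsWithin_of_forall fun t ht => ?_)
    refine tendsto_nhds_unique (((E.boundedIntegral (expQuotient S t)).continuous.tendsto y).comp h)
      ?_
    refine ((((t : ℂ)⁻¹ • (E.expGroup S t - 1)).continuous.tendsto x).comp
      (E.tendsto_proj_disk x)).congr fun n => ?_
    exact hkey n x t ht

end

omit [CompleteSpace X] in
theorem integral_expOn (hre : S ⊆ {z : ℂ | z.re = 0}) (t : ℝ) :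
    E.integral (expOn S t) = (E.expGroup S t : X →ₗ[ℂ] X).toPMap ⊤ := by
  have h : ∀ x, Tendsto (fun n => E.boundedIntegral (truncation (expOn S t) n) x) atTop
      (𝓝 (E.expGroup S t x)) := fun x => by
    refine tendsto_const_nhds.congr' ?_
    -- As `|expOn S t| ≤ 1`, truncation changes nothing from `n = 1` on.
    filter_upwards [eventually_ge_atTop 1] with n hn
    rw [expGroup, truncation, Set.indicator_eq_self.2]
    exact fun z _ => (norm_expOn_le hre t z).trans (by exact_mod_cast hn)
  refine LinearPMap.ext (Submodule.ext fun x => ⟨fun _ => trivial, fun _ => ⟨_, h x⟩⟩) ?_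
  intro x hx hx'
  exact tendsto_nhds_unique (tendsto_strongLimit ⟨x, hx⟩) (h x)

theorem dense_domain_integral_id : Dense ((E.integral fun z => z).domain : Set X) := fun x =>
  mem_closure_of_tendsto (E.tendsto_proj_disk x) (Eventually.of_forall fun n =>
    ⟨_, E.tendsto_idTrunc_proj (measurableSet_disk n) le_rfl x⟩)

end SpectralMeasure

/-! ### Uniqueness of the group with a given generator. -/

theorem tendsto_generator {T : ℝ → X →L[ℂ] X} {A : X →ₗ.[ℂ] X} (h : generator T = A)
    (x : A.domain) :
    Tendsto (fun t : ℝ => (t : ℂ)⁻¹ • (T t x - x)) (𝓝[≠] 0) (𝓝 (A x)) := by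
  subst h
  exact tendsto_strongLimit x

namespace IsStronglyContinuousGroup

variable {S T : ℝ → X →L[ℂ] X}

theorem apply_mem_domain_generator (hS : IsStronglyContinuousGroup S) {x : X}
    (hx : x ∈ (generator S).domain) (s : ℝ) : S s x ∈ (generator S).domain := by
  obtain ⟨y, hy⟩ := hx
  refine ⟨S s y, (((S s).continuous.tendsto y).comp hy).congr fun t => ?_⟩
  rw [Function.comp_apply, ← mul_apply_eq_comp, ← mul_apply_eq_comp]
  congr 1
  rw [mul_smul_comm, smul_mul_assoc, mul_sub, sub_mul, ← hS.map_add, ← hS.map_add, one_mul,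
    mul_one, add_comm]

/-- A strongly continuous group is determined by its densely defined generator, if one of the two
groups compared is bounded. -/
theorem eq_of_generator_eq (hS : IsStronglyContinuousGroup S) (hT : IsStronglyContinuousGroup T)
    {C : ℝ} (hC : ∀ t, ‖T t‖ ≤ C) (h : generator S = generator T)
    (hd : Dense ((generator T).domain : Set X)) : S = T := by
  have hzero : ∀ w ∈ (generator T).domain,
      HasDerivAt (fun t : ℝ => T (-t) (S t w)) 0 0 := fun w hw => by
    have h1 := tendsto_generator h ⟨w, hw⟩
    have h2 := tendsto_generator rfl (T := T) ⟨w, hw⟩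
    set y := generator T ⟨w, hw⟩
    have hneg : Tendsto (fun t : ℝ => -t) (𝓝[≠] 0) (𝓝[≠] 0) := by
      refine tendsto_nhdsWithin_iff.2 ⟨?_, eventually_nhdsWithin_of_forall fun t ht => neg_ne_zero.2 ht⟩
      simpa using (continuous_neg.tendsto (0 : ℝ)).mono_left nhdsWithin_le_nhds
    have h3 := h2.comp hneg
    have h4 : Tendsto (fun t => T (-t) y) (𝓝[≠] 0) (𝓝 y) := by
      have := ((hT.continuous y).tendsto 0).comp (hneg.mono_right nhdsWithin_le_nhds)
      simpa [hT.map_zero, Function.comp_def] using this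
    -- The bound `C` on `T` lets the varying operator `T (-t)` act on a vector tending to zero.
    have h5 : Tendsto (fun t => T (-t) ((t : ℂ)⁻¹ • (S t w - w) - y)) (𝓝[≠] 0) (𝓝 0) := by
      have h6 := (tendsto_iff_norm_sub_tendsto_zero.1 h1).const_mul C
      rw [mul_zero] at h6
      exact squeeze_zero_norm (fun t => ((T (-t)).le_opNorm _).trans (by gcongr; exact hC _)) h6
    rw [hasDerivAt_iff_tendsto_slope_zero]
    have h7 := (h5.add h4).sub h3
    rw [zero_add, sub_self] at h7
    refine h7.congr fun t => ?_
    rw [← _root_.map_add, sub_add_cancel, map_smul, map_sub, ← Complex.coe_smul]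
    simp only [Function.comp_apply, zero_add, neg_zero, hS.map_zero, hT.map_zero,
      one_apply_eq_self, Complex.ofReal_neg, Complex.ofReal_inv, inv_neg, neg_smul, smul_sub]
    abel
  have hderiv : ∀ x ∈ (generator T).domain, ∀ s : ℝ,
      HasDerivAt (fun t : ℝ => T (-t) (S t x)) 0 s := fun x hx s => by
    have hw : S s x ∈ (generator T).domain := by
      rw [← h] at hx ⊢
      exact hS.apply_mem_domain_generator hx s
    have h1 := hzero _ hw
    rw [← sub_self s] at h1
    -- The group laws move the derivative from `0` to `s`: `T(-t) S(t) x = T(-s) T(-(t-s)) S(t-s)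
    -- (S(s) x)`.
    have h2 := ((T (-s)).restrictScalars ℝ).hasFDerivAt.comp_hasDerivAt s (h1.comp_sub_const s s)
    rw [_root_.map_zero] at h2
    refine h2.congr_of_eventuallyEq (Eventually.of_forall fun t => ?_)
    change T (-t) (S t x) = (T (-s)) (T (-(t - s)) (S (t - s) (S s x)))
    rw [← mul_apply_eq_comp (S _), ← hS.map_add, ← mul_apply_eq_comp (T (-s)), ← hT.map_add]
    congr 2 <;> ring_nf
  have hconst : ∀ x ∈ (generator T).domain, ∀ s, S s x = T s x := fun x hx s => by
    have h1 := is_const_of_deriv_eq_zero (fun s => (hderiv x hx s).differentiableAt)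
      (fun s => (hderiv x hx s).deriv) s 0
    simp only [neg_zero, hS.map_zero, hT.map_zero] at h1
    have h2 := congrArg (T s) h1
    rw [← mul_apply_eq_comp, ← hT.map_add, add_neg_cancel, hT.map_zero] at h2
    exact h2
  ext s x
  exact congrFun (Continuous.ext_on hd (S s).continuous (T s).continuous
    fun x hx => hconst x hx s) x

end IsStronglyContinuousGroup

end ScalarSpectral

end

/-! ### The main theorem. -/

theorem proposition3p1 {X : Type*} [NormedAddCommGroup X] [NormedSpace ℂ X] [CompleteSpace X]
    (A : X →ₗ.[ℂ] X) (E : ScalarSpectral.SpectralMeasure X) (hA : E.IsSpectralMeasureOf A)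
    (hσ : ScalarSpectral.spectrum A ⊆ {z : ℂ | z.re = 0}) :
    ∃ T : ℝ → X →L[ℂ] X,
      -- `T` is the unique strongly continuous group generated by `A`, and `T t = e^{tA}`
      ScalarSpectral.IsStronglyContinuousGroup T ∧
      ScalarSpectral.generator T = A ∧
      (∀ S : ℝ → X →L[ℂ] X, ScalarSpectral.IsStronglyContinuousGroup S →
        ScalarSpectral.generator S = A → S = T) ∧
      (∀ t : ℝ, E.expOp A t = (T t : X →ₗ[ℂ] X).toPMap ⊤) ∧
      -- the spectral measure is bounded, and every bound `M` for it yields `‖e^{tA}‖ ≤ 4M`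
      (∃ M : ℝ, 1 ≤ M ∧ ∀ δ : Set ℂ, MeasurableSet δ → ‖E δ‖ ≤ M) ∧
      (∀ M : ℝ, (∀ δ : Set ℂ, MeasurableSet δ → ‖E δ‖ ≤ M) → ∀ t : ℝ, ‖T t‖ ≤ 4 * M) ∧
      -- the group and each of its orbits are bounded
      (∃ C : ℝ, ∀ t : ℝ, ‖T t‖ ≤ C) ∧
      (∀ f : X, Bornology.IsBounded (Set.range fun t : ℝ => T t f)) ∧
      -- the group is not hypercyclic
      ¬ ScalarSpectral.IsHypercyclic (fun t : ℝ => E.expOp A t) := by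
  subst hA
  set S := ScalarSpectral.spectrum (E.integral fun z => z)
  have hS : MeasurableSet S := ScalarSpectral.measurableSet_spectrum _
  have hES : E S = 1 := E.proj_spectrum
  have hT := E.isStronglyContinuousGroup_expGroup hS hσ hES
  have hgen := E.generator_expGroup hS hσ hES
  have hexp : ∀ t : ℝ, E.expOp (E.integral fun z => z) t =
      (E.expGroup S t : X →ₗ[ℂ] X).toPMap ⊤ := E.integral_expOn hσ
  obtain ⟨M, hM1, hM⟩ := E.exists_norm_le
  have hC := E.norm_expGroup_le hS hσ hM
  have hbdd : ∀ f : X, Bornology.IsBounded (Set.range fun t : ℝ => E.expGroup S t f) := fun f =>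
    isBounded_iff_forall_norm_le.2 ⟨4 * M * ‖f‖, by
      rintro _ ⟨t, rfl⟩
      exact (E.expGroup S t).le_of_opNorm_le (hC t) f⟩
  refine ⟨E.expGroup S, hT, hgen, fun U hU hUgen => ?_, hexp, ⟨M, hM1, hM⟩,
    fun M hM t => E.norm_expGroup_le hS hσ hM t, ⟨4 * M, hC⟩, hbdd, ?_⟩
  · refine hU.eq_of_generator_eq hT hC (hUgen.trans hgen.symm) ?_
    rw [hgen]
    exact E.dense_domain_integral_id
  · rintro ⟨f, hf, hdom, hdense⟩
    have hrange : (Set.range fun t : ℝ => E.expOp (E.integral fun z => z) t ⟨f, hdom t⟩) =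
        Set.range fun t : ℝ => E.expGroup S t f :=
      congrArg Set.range (funext fun t => by
        have h := (LinearPMap.ext_iff.1 (hexp t)).2
        exact @h f (hdom t) trivial)
    rw [hrange] at hdense
    -- The closure of a bounded dense orbit would be all of `X`, yet `f ≠ 0` makes `X` unbounded.
    have huniv : Bornology.IsBounded (Set.univ : Set X) := by
      rw [← hdense.closure_eq]
      exact (hbdd f).closure
    have : Nontrivial X := ⟨⟨f, 0, hf⟩⟩
    exact NormedSpace.unbounded_univ ℂ X huniv
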